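/- An mm-space $X$ is a complete separable metric space $(X,d_X)$ with a Borel probability measure $\mu_X$ of full support. $\mathrm{Aut}(X)$ is the group of measure-preserving isometries of $X$ onto itself, with the topology of pointwise convergence (equivalently, of convergence in measure). Let $\mathcal X_{\rm eq}$ be the class of pairs $(X,G)$ where $X$ is an mm-space and $G$ is a closed subgroup of $\mathrm{Aut}(X)$. The quotient $X/G$ is the mm-space of $G$-orbits with the distance between orbits, $d_{X/G}([x],[y])=\inf\{d_X(x',y') : x'\in Gx,\ y'\in Gy\}$, and the push-forward of $\mu_X$ under $X\to X/G$. Let $\mathrm{Lip}_1(X)$ be the set of $1$-Lipschitz functions $X\to\mathbb R$, and let $\Pi(X,Y)$ be the set of couplings of $\mu_X$ and $\mu_Y$. For $\pi\in\Pi(X,Y)$ let $d_{KF}^\pi(u,v)=\inf\{\varepsilon\ge 0 : \pi(|u-v|>\varepsilon)\le\varepsilon\}$ be the Ky Fan metric on Borel functions on $X\times Y$. The Hausdorff distance of two sets $A,B$ with respect to $\rho:A\times B\to[0,\infty]$ is $\max\{\sup_{a\in A}\inf_{b\in B}\rho(a,b),\ \sup_{b\in B}\inf_{a\in A}\rho(a,b)\}$.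 For $(X,G),(Y,H)\in\mathcal X_{\rm eq}$, $g\in G$, $h\in H$, let $\rho^\pi(g,h)$ be the Hausdorff distance of $\mathrm{Lip}_1(X)$ and $\mathrm{Lip}_1(Y)$ with respect to $$\rho^\pi_{g,h}(f,f')=\max\{d_{KF}^\pi(f\circ p_1,f'\circ p_2),\ d_{KF}^\pi(f\circ g\circ p_1,f'\circ h\circ p_2)\},$$ where $p_1,p_2$ are the projections of $X\times Y$; let $d_{\rm conc}^\pi((X,G),(Y,H))$ be the Hausdorff distance of $G$ and $H$ with respect to $\rho^\pi$, and put $$d_{\rm conc}((X,G),(Y,H))=\inf_{\pi\in\Pi(X,Y)}d_{\rm conc}^\pi((X,G),(Y,H)),\qquad d_{\rm conc}(X,Y)=d_{\rm conc}((X,\{\mathrm{id}_X\}),(Y,\{\mathrm{id}_Y\})).$$ For $\kappa>0$ let $\mathrm{ObsDiam}(X;-\kappa)=\sup_{f\in\mathrm{Lip}_1(X)}\mathrm{diam}(f_*\mu_X;-\kappa)$, where $\mathrm{diam}(\nu;-\kappa)$ is the infimum of the diameters of the Borel sets $A\subset\mathbb R$ with $\nu(A)\ge 1-\kappa$. **Theorem.**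 For all $(X,G),(Y,H)\in\mathcal X_{\rm eq}$ and $\kappa>0$, with $D_\kappa:=\max\{\mathrm{ObsDiam}(X;-\kappa),\mathrm{ObsDiam}(Y;-\kappa)\}$, $$d_{\rm conc}(X/G,Y/H)\le\sqrt{3(D_\kappa+1)\,d_{\rm conc}((X,G),(Y,H))}+\kappa.$$ In particular, if $(X_n,G_n),(Y,H)\in\mathcal X_{\rm eq}$, $n=1,2,\dots$, satisfy $d_{\rm conc}((X_n,G_n),(Y,H))\to 0$, then $d_{\rm conc}(X_n/G_n,Y/H)\to 0$. -/

import Mathlib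

open MeasureTheory Set Filter Topology
open scoped ENNReal NNReal

universe u v

/-- An mm-space: a complete separable metric space with a Borel probability measure
of full support. -/
structure MMSpace : Type (u + 1) where
  carrier : Type u
  [metric : MetricSpace carrier]
  [complete : CompleteSpace carrier]
  [separable : TopologicalSpace.SeparableSpace carrier]
  [measurable : MeasurableSpace carrier]
  [borel : BorelSpace carrier]
  μ : Measure carrier
  [prob : IsProbabilityMeasure μ]
  [fullSupport : μ.IsOpenPosMeasure]

namespace MMSpace

instance : CoeSort MMSpace.{u} (Type u) := ⟨MMSpace.carrier⟩

attribute [instance] metric complete separable measurable borel prob fullSupport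

instance (X : MMSpace.{u}) : Nonempty X := nonempty_of_isProbabilityMeasure X.μ

/-- The group `Aut(X)` of measure preserving isometries of `X` onto itself. -/
def Aut (X : MMSpace.{u}) : Subgroup (X ≃ᵢ X) where
  carrier := {g | X.μ.map g = X.μ}
  mul_mem' {a b} ha hb := by
    have h : X.μ.map (a * b : X ≃ᵢ X) = (X.μ.map b).map a :=
      (Measure.map_map a.continuous.measurable b.continuous.measurable).symm
    simp only [mem_ofPred_eq] at *
    rw [h, hb, ha]
  one_mem' := Measure.map_id
  inv_mem' {a} ha := by
    simp only [mem_ofPred_eq] at *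
    conv_lhs => rw [← ha]
    rw [Measure.map_map (a⁻¹).continuous.measurable a.continuous.measurable]
    have h : ((a⁻¹ : X ≃ᵢ X) : X → X) ∘ a = id := by
      funext x; exact a.symm_apply_apply x
    rw [h, Measure.map_id]

instance (X : MMSpace.{u}) : FunLike X.Aut X X where
  coe g := g.1
  coe_injective _ _ e := Subtype.ext (DFunLike.coe_injective e)

/-- `Aut(X)` carries the topology of pointwise convergence (which, on this group, is also the
topology of convergence in measure). -/
instance (X : MMSpace.{u}) : TopologicalSpace X.Aut :=
  TopologicalSpace.induced (fun g => (g : X → X)) inferInstance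

section Aut

variable {X : MMSpace.{u}}

theorem Aut.isometry (g : X.Aut) : Isometry g := g.1.isometry

theorem Aut.map_eq (g : X.Aut) : X.μ.map g = X.μ := g.2

@[simp] theorem Aut.one_apply (x : X) : (1 : X.Aut) x = x := rfl

@[simp] theorem Aut.mul_apply (g h : X.Aut) (x : X) : (g * h) x = g (h x) := rfl

@[simp] theorem Aut.inv_apply_self (g : X.Aut) (x : X) : g⁻¹ (g x) = x :=
  g.1.symm_apply_apply x

@[simp] theorem Aut.apply_inv_self (g : X.Aut) (x : X) : g (g⁻¹ x) = x :=
  g.1.apply_symm_apply x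

theorem Aut.isInducing_coe :
    IsInducing (fun g : X.Aut => (g : X → X)) := ⟨rfl⟩

instance : T2Space X.Aut :=
  T2Space.of_injective_continuous DFunLike.coe_injective Aut.isInducing_coe.continuous

theorem Aut.continuous_apply (x : X) : Continuous (fun g : X.Aut => g x) :=
  (_root_.continuous_apply x).comp Aut.isInducing_coe.continuous

theorem Aut.totallyBounded_orbit (x : X) : TotallyBounded (range fun g : X.Aut => g x) := by
  rw [Metric.totallyBounded_iff]
  intro ε hε
  let d := TopologicalSpace.denseSeq X
  have hcov : (⋃ n, Metric.ball (d n) (ε / 2)) = univ := by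
    refine eq_univ_of_forall fun y => ?_
    obtain ⟨n, hn⟩ := (TopologicalSpace.denseRange_denseSeq X).exists_dist_lt y (half_pos hε)
    exact mem_iUnion.2 ⟨n, hn⟩
  have hlim := tendsto_measure_iUnion_accumulate (μ := X.μ)
    (f := fun n => Metric.ball (d n) (ε / 2))
  rw [hcov, measure_univ] at hlim
  have hpos : 0 < X.μ (Metric.ball x (ε / 2)) :=
    Metric.isOpen_ball.measure_pos _ ⟨x, Metric.mem_ball_self (half_pos hε)⟩
  have hlt : 1 - X.μ (Metric.ball x (ε / 2)) < 1 :=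
    ENNReal.sub_lt_self ENNReal.one_ne_top one_ne_zero hpos.ne'
  obtain ⟨n, hn⟩ := (hlim.eventually (lt_mem_nhds hlt)).exists
  refine ⟨d '' Iic n, (finite_Iic n).image _, ?_⟩
  rintro _ ⟨g, rfl⟩
  have hg : X.μ (Metric.ball (g x) (ε / 2)) = X.μ (Metric.ball x (ε / 2)) := by
    conv_lhs => rw [← Aut.map_eq g]
    rw [Measure.map_apply (Aut.isometry g).continuous.measurable Metric.isOpen_ball.measurableSet]
    congr 1
    ext z
    simp [(Aut.isometry g).dist_eq]
  have hne : ¬ Disjoint (Metric.ball (g x) (ε / 2)) (accumulate (fun n => Metric.ball (d n) (ε / 2)) n) := by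
    intro hdis
    have h1 := measure_union (μ := X.μ) hdis
      (MeasurableSet.biUnion (to_countable _) fun i _ => Metric.isOpen_ball.measurableSet)
    have h2 : X.μ (Metric.ball (g x) (ε / 2) ∪
      accumulate (fun n => Metric.ball (d n) (ε / 2)) n) ≤ 1 := prob_le_one
    rw [h1, hg] at h2
    have h3 := ENNReal.sub_lt_iff_lt_right (measure_ne_top X.μ (Metric.ball x (ε / 2)))
      (prob_le_one) |>.1 hn
    rw [add_comm] at h3
    exact absurd h3 (not_lt.2 h2)
  obtain ⟨z, hz1, hz2⟩ := not_disjoint_iff.1 hne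
  obtain ⟨k, hk, hzk⟩ := mem_accumulate.1 hz2
  refine mem_iUnion₂.2 ⟨d k, ⟨k, hk, rfl⟩, ?_⟩
  rw [Metric.mem_ball] at *
  have := dist_triangle_left (g x) (d k) z
  linarith

/-- A pointwise limit of measure preserving isometries preserves the measure. -/
theorem Aut.map_eq_of_tendsto (g : ℕ → X.Aut) (φ : X → X) (hφ : Isometry φ)
    (h : ∀ x, Tendsto (fun n => g n x) atTop (𝓝 (φ x))) : X.μ.map φ = X.μ := by
  have : IsProbabilityMeasure (X.μ.map φ) :=
    Measure.isProbabilityMeasure_map hφ.continuous.aemeasurable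
  refine ext_of_forall_integral_eq_of_IsFiniteMeasure fun f => ?_
  rw [integral_map hφ.continuous.aemeasurable f.continuous.aestronglyMeasurable]
  have h1 : Tendsto (fun n => ∫ x, f (g n x) ∂X.μ) atTop (𝓝 (∫ x, f (φ x) ∂X.μ)) := by
    refine tendsto_integral_of_dominated_convergence (fun _ => ‖f‖) (fun n => ?_)
      (integrable_const _) (fun n => ae_of_all _ fun x => f.norm_coe_le_norm _)
      (ae_of_all _ fun x => (f.continuous.tendsto _).comp (h x))
    exact (f.continuous.comp (Aut.isometry (g n)).continuous).aestronglyMeasurable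
  have h2 : ∀ n, ∫ x, f (g n x) ∂X.μ = ∫ x, f x ∂X.μ := fun n => by
    conv_rhs => rw [← Aut.map_eq (g n)]
    rw [integral_map (Aut.isometry (g n)).continuous.aemeasurable f.continuous.aestronglyMeasurable]
  simp only [h2] at h1
  exact tendsto_nhds_unique h1 tendsto_const_nhds

instance : CompactSpace X.Aut := by
  refine ⟨isCompact_iff_ultrafilter_le_nhds.2 fun U _ => ?_⟩
  have key : ∀ (V : Ultrafilter X.Aut) (x : X), ∃ y,
      Tendsto (fun g : X.Aut => g x) V (𝓝 y) := by
    intro V x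
    have hc : IsCompact (closure (range fun g : X.Aut => g x)) :=
      (Aut.totallyBounded_orbit x).closure.isCompact_of_isClosed isClosed_closure
    obtain ⟨y, -, hy⟩ := hc.ultrafilter_le_nhds (V.map fun g : X.Aut => g x)
      (le_principal_iff.2 (Filter.mem_map.2 (univ_mem' fun g =>
        subset_closure (mem_range_self g))))
    exact ⟨y, hy⟩
  choose φ hφ using key U
  choose ψ hψ' using key (U.map fun g => g⁻¹)
  have hψ : ∀ x, Tendsto (fun g : X.Aut => g⁻¹ x) U (𝓝 (ψ x)) := fun x => hψ' x
  have isoφ : Isometry φ := Isometry.of_dist_eq fun x y =>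
    tendsto_nhds_unique ((hφ x).dist (hφ y))
      (by simp only [(Aut.isometry _).dist_eq]; exact tendsto_const_nhds)
  have hψφ : ∀ x, ψ (φ x) = x := fun x => by
    have h0 : Tendsto (fun g : X.Aut => dist (g⁻¹ (φ x)) x) U (𝓝 0) := by
      have : ∀ g : X.Aut, dist (g⁻¹ (φ x)) x = dist (g x) (φ x) := fun g => by
        rw [← (Aut.isometry g).dist_eq, Aut.apply_inv_self, dist_comm]
      simp only [this]
      exact tendsto_iff_dist_tendsto_zero.1 (hφ x)
    exact tendsto_nhds_unique (hψ (φ x)) (tendsto_iff_dist_tendsto_zero.2 h0)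
  have hφψ : ∀ x, φ (ψ x) = x := fun x => by
    have h0 : Tendsto (fun g : X.Aut => dist (g (ψ x)) x) U (𝓝 0) := by
      have : ∀ g : X.Aut, dist (g (ψ x)) x = dist (g⁻¹ x) (ψ x) := fun g => by
        rw [← (Aut.isometry g⁻¹).dist_eq, Aut.inv_apply_self, dist_comm]
      simp only [this]
      exact tendsto_iff_dist_tendsto_zero.1 (hψ x)
    exact tendsto_nhds_unique (hφ (ψ x)) (tendsto_iff_dist_tendsto_zero.2 h0)
  have hmap : X.μ.map φ = X.μ := by
    let d := TopologicalSpace.denseSeq X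
    have hev : ∀ n : ℕ, ∃ g : X.Aut, ∀ k ≤ n, dist (g (d k)) (φ (d k)) < 1 / ((n : ℝ) + 1) :=
      fun n => Eventually.exists (f := (U : Filter X.Aut))
        ((eventually_all_finite (finite_Iic n)).2 fun k _ =>
          (hφ (d k)).eventually (Metric.ball_mem_nhds _ Nat.one_div_pos_of_nat))
    choose g hg using hev
    refine Aut.map_eq_of_tendsto g φ isoφ fun x => Metric.tendsto_atTop.2 fun ε hε => ?_
    obtain ⟨k, hk⟩ := (TopologicalSpace.denseRange_denseSeq X).exists_dist_lt x
      (show 0 < ε / 3 by positivity)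
    obtain ⟨N, hN⟩ := exists_nat_one_div_lt (show 0 < ε / 3 by positivity)
    refine ⟨max k N, fun n hn => ?_⟩
    have h1 := hg n k (le_trans (le_max_left _ _) hn)
    have h2 : 1 / ((n : ℝ) + 1) ≤ 1 / ((N : ℝ) + 1) :=
      Nat.one_div_le_one_div (le_trans (le_max_right _ _) hn)
    have h3 := dist_triangle4 (g n x) (g n (d k)) (φ (d k)) (φ x)
    rw [(Aut.isometry (g n)).dist_eq, isoφ.dist_eq, dist_comm (d k) x] at h3
    linarith
  refine ⟨⟨⟨⟨φ, ψ, hψφ, hφψ⟩, isoφ⟩, hmap⟩, trivial, ?_⟩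
  rw [Aut.isInducing_coe.nhds_eq_comap, ← tendsto_iff_comap]
  exact tendsto_pi_nhds.2 hφ

end Aut

end MMSpace

/-- An mm-space `X` together with a closed subgroup `G` of `Aut(X)`, i.e. a representative
`(X, G)` of a point of the space of mm-spaces with group actions. -/
structure EqMMSpace : Type (u + 1) where
  space : MMSpace.{u}
  group : Subgroup space.Aut
  isClosed_group : IsClosed (group : Set space.Aut)

namespace EqMMSpace

/-- The relation of lying in the same `G`-orbit. -/
def orbitSetoid (P : EqMMSpace.{u}) : Setoid P.space where
  r x y := ∃ g ∈ P.group, g x = y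
  iseqv :=
    { refl := fun _ => ⟨1, P.group.one_mem, rfl⟩
      symm := by
        rintro x _ ⟨g, hg, rfl⟩
        exact ⟨g⁻¹, P.group.inv_mem hg, MMSpace.Aut.inv_apply_self g x⟩
      trans := by
        rintro x _ _ ⟨g, hg, rfl⟩ ⟨h, hh, rfl⟩
        exact ⟨h * g, P.group.mul_mem hh hg, rfl⟩ }

/-- The set `X/G` of `G`-orbits. -/
def Orbits (P : EqMMSpace.{u}) : Type u := Quotient P.orbitSetoid

/-- The quotient map `X → X/G`. -/
def proj (P : EqMMSpace.{u}) : P.space → P.Orbits := Quotient.mk P.orbitSetoid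

variable {P : EqMMSpace.{u}}

theorem proj_surjective : Function.Surjective P.proj := Quotient.mk_surjective

theorem proj_eq_proj_iff {x y : P.space} : P.proj x = P.proj y ↔ ∃ g ∈ P.group, g x = y :=
  Quotient.eq (r := P.orbitSetoid)

theorem proj_apply {g : P.space.Aut} (hg : g ∈ P.group) (x : P.space) :
    P.proj (g x) = P.proj x := (proj_eq_proj_iff.2 ⟨g, hg, rfl⟩).symm

/-- The distance in `X/G` is the distance between orbits, that is, the infimum of `d(x, y)` over
`x` in the first orbit and `y` in the second. -/
noncomputable instance : Dist P.Orbits where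
  dist a b := ⨅ p : {p : P.space × P.space // P.proj p.1 = a ∧ P.proj p.2 = b},
    dist p.1.1 p.1.2

theorem dist_proj_le (x y : P.space) : dist (P.proj x) (P.proj y) ≤ dist x y :=
  ciInf_le (f := fun p : {p : P.space × P.space // P.proj p.1 = P.proj x ∧ P.proj p.2 = P.proj y} =>
    dist p.1.1 p.1.2) ⟨0, by rintro _ ⟨p, rfl⟩; exact dist_nonneg⟩ ⟨(x, y), rfl, rfl⟩

theorem dist_proj_lt_iff {x : P.space} {b : P.Orbits} {ε : ℝ} :
    dist (P.proj x) b < ε ↔ ∃ y, P.proj y = b ∧ dist x y < ε := by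
  constructor
  · intro h
    obtain ⟨z, rfl⟩ := proj_surjective b
    have : Nonempty {p : P.space × P.space // P.proj p.1 = P.proj x ∧ P.proj p.2 = P.proj z} :=
      ⟨⟨(x, z), rfl, rfl⟩⟩
    obtain ⟨⟨⟨x', y'⟩, hx, hy⟩, hlt⟩ := exists_lt_of_ciInf_lt h
    obtain ⟨g, hg, rfl⟩ := proj_eq_proj_iff.1 hx
    exact ⟨g y', (proj_apply hg y').trans hy, by rwa [(MMSpace.Aut.isometry g).dist_eq]⟩
  · rintro ⟨y, rfl, h⟩
    exact (dist_proj_le x y).trans_lt h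

theorem isClosed_orbit (x : P.space) : IsClosed {y | P.proj y = P.proj x} := by
  have h : {y | P.proj y = P.proj x} =
      (fun g : P.space.Aut => g x) '' (P.group : Set P.space.Aut) := by
    ext y
    exact eq_comm.trans proj_eq_proj_iff
  rw [h]
  exact (P.isClosed_group.isCompact.image (MMSpace.Aut.continuous_apply x)).isClosed

noncomputable instance : MetricSpace P.Orbits where
  dist_self a := by
    obtain ⟨x, rfl⟩ := proj_surjective a
    refine le_antisymm ((dist_proj_le x x).trans_eq (dist_self x)) ?_
    exact Real.iInf_nonneg fun p => dist_nonneg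
  dist_comm a b := by
    refine le_antisymm ?_ ?_ <;>
    · refine le_of_forall_gt_imp_ge_of_dense fun ε hε => ?_
      obtain ⟨x, rfl⟩ := proj_surjective a
      obtain ⟨y, rfl⟩ := proj_surjective b
      obtain ⟨z, hz, hlt⟩ := dist_proj_lt_iff.1 hε
      rw [← hz]
      exact (dist_proj_le _ _).trans (by rw [dist_comm]; exact hlt.le)
  dist_triangle a b c := by
    refine le_of_forall_pos_le_add fun ε hε => ?_
    obtain ⟨x, rfl⟩ := proj_surjective a
    obtain ⟨y, rfl, hy⟩ := dist_proj_lt_iff.1 (lt_add_of_pos_right (dist (P.proj x) b) (half_pos hε))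
    obtain ⟨z, rfl, hz⟩ := dist_proj_lt_iff.1 (lt_add_of_pos_right (dist (P.proj y) c) (half_pos hε))
    have := dist_proj_le x z
    have := dist_triangle x y z
    linarith
  eq_of_dist_eq_zero {a b} h := by
    obtain ⟨x, rfl⟩ := proj_surjective a
    obtain ⟨y, rfl⟩ := proj_surjective b
    have : x ∈ closure {z | P.proj z = P.proj y} := by
      refine Metric.mem_closure_iff.2 fun ε hε => ?_
      obtain ⟨z, hz, hlt⟩ := dist_proj_lt_iff.1 (h.trans_lt hε)
      exact ⟨z, hz, hlt⟩
    rwa [(isClosed_orbit y).closure_eq] at this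

theorem continuous_proj : Continuous P.proj :=
  (LipschitzWith.of_dist_le_mul (K := 1) fun x y => by
    simpa using dist_proj_le x y).continuous

instance : TopologicalSpace.SeparableSpace P.Orbits :=
  proj_surjective.denseRange.separableSpace continuous_proj

instance : CompleteSpace P.Orbits := by
  refine Metric.complete_of_convergent_controlled_sequences (fun n => (1 / 2 : ℝ) ^ n)
    (fun n => by positivity) fun a ha => ?_
  have step : ∀ n (x : P.space), P.proj x = a n →
      ∃ y, P.proj y = a (n + 1) ∧ dist x y < (1 / 2 : ℝ) ^ n := fun n x hx =>
    dist_proj_lt_iff.1 (hx ▸ ha n n (n + 1) le_rfl n.le_succ)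
  choose f hf using step
  obtain ⟨x0, hx0⟩ := proj_surjective (a 0)
  let w : (n : ℕ) → {x : P.space // P.proj x = a n} := fun n =>
    Nat.rec ⟨x0, hx0⟩ (fun n x => ⟨f n x.1 x.2, (hf n x.1 x.2).1⟩) n
  have hw : ∀ n, dist (w n).1 (w (n + 1)).1 ≤ 1 * (1 / 2 : ℝ) ^ n := fun n => by
    rw [one_mul]
    exact (hf n (w n).1 (w n).2).2.le
  obtain ⟨x, hx⟩ := cauchySeq_tendsto_of_complete
    (cauchySeq_of_le_geometric (1 / 2 : ℝ) 1 (by norm_num) hw)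
  refine ⟨P.proj x, ?_⟩
  have := (continuous_proj.tendsto x).comp hx
  exact this.congr fun n => (w n).2

noncomputable instance : MeasurableSpace P.Orbits := borel P.Orbits

instance : BorelSpace P.Orbits := ⟨rfl⟩

variable (P) in
/-- The quotient mm-space `X/G`, with the distance between orbits and the push-forward of the
measure of `X` by the quotient map. -/
noncomputable def quotient : MMSpace.{u} where
  carrier := P.Orbits
  μ := P.space.μ.map P.proj
  prob := Measure.isProbabilityMeasure_map continuous_proj.aemeasurable
  fullSupport := ⟨fun U hU hne => by
    rw [Measure.map_apply continuous_proj.measurable hU.measurableSet]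
    exact ((hU.preimage continuous_proj).measure_pos _
      (hne.preimage proj_surjective)).ne'⟩

end EqMMSpace

/-- The set `Π(X, Y)` of couplings between the measures of `X` and `Y`. -/
def Couplings (X : MMSpace.{u}) (Y : MMSpace.{v}) : Set (Measure (X × Y)) :=
  {π | π.map Prod.fst = X.μ ∧ π.map Prod.snd = Y.μ}

/-- The set of real valued `1`-Lipschitz functions on `X`. -/
def Lip1 (X : MMSpace.{u}) : Set (X → ℝ) := {f | LipschitzWith 1 f}

/-- The Ky Fan distance `inf {ε | μ(|f - g| > ε) ≤ ε}` of two functions. -/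
noncomputable def kyFan {Ω : Type*} [MeasurableSpace Ω] (μ : Measure Ω) (f g : Ω → ℝ) : ℝ≥0∞ :=
  sInf {ε | μ {ω | ε < edist (f ω) (g ω)} ≤ ε}

/-- The Hausdorff distance between two sets `A` and `B` with respect to the distances `ρ a b`
between the elements of `A` and those of `B`. -/
noncomputable def hausdorffDistOf {α β : Type*} (A : Set α) (B : Set β) (ρ : α → β → ℝ≥0∞) :
    ℝ≥0∞ :=
  max (⨆ a ∈ A, ⨅ b ∈ B, ρ a b) (⨆ b ∈ B, ⨅ a ∈ A, ρ a b)

/-- The distance `ρ^π(g, h)`: the Hausdorff distance between the sets of `1`-Lipschitz functions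
on `X` and on `Y`, with respect to
`max (d_KF^π(f ∘ p₁, f' ∘ p₂)) (d_KF^π(f ∘ g ∘ p₁, f' ∘ h ∘ p₂))`. -/
noncomputable def rhoDist {X : MMSpace.{u}} {Y : MMSpace.{v}} (π : Measure (X × Y))
    (g : X.Aut) (h : Y.Aut) : ℝ≥0∞ :=
  hausdorffDistOf (Lip1 X) (Lip1 Y) fun f f' =>
    max (kyFan π (fun p => f p.1) (fun p => f' p.2))
      (kyFan π (fun p => f (g p.1)) (fun p => f' (h p.2)))

/-- The equivariant observable distance `d_conc((X, G), (Y, H))`. -/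
noncomputable def eqObsDist (P : EqMMSpace.{u}) (Q : EqMMSpace.{v}) : ℝ≥0∞ :=
  ⨅ π ∈ Couplings P.space Q.space,
    hausdorffDistOf (P.group : Set P.space.Aut) (Q.group : Set Q.space.Aut) (rhoDist π)

/-- The mm-space `X` with the trivial group `{id}`. -/
def MMSpace.trivialAction (X : MMSpace.{u}) : EqMMSpace.{u} where
  space := X
  group := ⊥
  isClosed_group := by
    rw [Subgroup.coe_bot]
    exact isClosed_singleton

/-- The observable distance `d_conc(X, Y) = d_conc((X, {id}), (Y, {id}))`. -/
noncomputable def obsDist (X : MMSpace.{u}) (Y : MMSpace.{v}) : ℝ≥0∞ :=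
  eqObsDist X.trivialAction Y.trivialAction

/-- The partial diameter `diam(ν; -κ)`: the infimum of the diameters of the Borel sets of
`ν`-measure at least `1 - κ`. -/
noncomputable def partialDiam (ν : Measure ℝ) (κ : ℝ) : ℝ≥0∞ :=
  ⨅ A ∈ {A : Set ℝ | MeasurableSet A ∧ ENNReal.ofReal (1 - κ) ≤ ν A}, Metric.ediam A

/-- The `κ`-observable diameter `ObsDiam(X; -κ)`. -/
noncomputable def obsDiam (X : MMSpace.{u}) (κ : ℝ) : ℝ≥0∞ :=
  ⨆ f ∈ Lip1 X, partialDiam (X.μ.map f) κ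

/-! ### Ky Fan estimates -/

section KyFan

variable {Ω : Type*} [MeasurableSpace Ω] {μ : Measure Ω} {f g k : Ω → ℝ} {s t : ℝ≥0∞}

/-! A nearly optimal coupling `π` of `X` and `Y` is pushed forward to `X/G` and `Y/H`. A 1-Lipschitz
function on `X/G` lifts to a `G`-invariant `u` on `X`. For each `k ∈ H`, a partner `g ∈ G` yields a
1-Lipschitz `f'` on `Y` with both `f'` and `f' ∘ k` within `δ` of `u`, since `u ∘ g = u`. This `f'`
depends on `k`, but any two choices are `2δ`-close and `k` preserves the measure, so one fixed
choice `f` has all its translates `f ∘ k` within `3δ` of `u` (`exists_lip1_quotient_kyFan_le`).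

The closed group `H` is compact, so `f` can be averaged over its Haar measure; the average is
invariant, hence a 1-Lipschitz function on `Y/H`. Ky Fan closeness does not survive averaging but
`L¹` closeness does: clamping to an interval of length about `D_κ` that carries `u` up to mass `κ`
turns `3δ` into an `L¹` bound `3δ(D_κ + 1)`, and Markov's inequality turns that into the square root
(`exists_lip1_quotient_average`). Undoing the clamp on `u` costs `κ`.

For convergence, closeness to `Y` bounds the observable diameters of the `X_n` uniformly
(`obsDiam_le_of_eqObsDist_lt`). -/

theorem measure_lt_edist_mono (h : μ {ω | s < edist (f ω) (g ω)} ≤ s) (hst : s ≤ t) :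
    μ {ω | t < edist (f ω) (g ω)} ≤ t :=
  (measure_mono fun _ hω => hst.trans_lt hω).trans (h.trans hst)

/-- Admissible thresholds are upward closed, so a strict bound makes `t` itself admissible and no
attainment of the infimum is needed. -/
theorem measure_lt_edist_of_kyFan_lt (h : kyFan μ f g < t) :
    μ {ω | t < edist (f ω) (g ω)} ≤ t := by
  obtain ⟨s, hs, hst⟩ := sInf_lt_iff.1 h
  exact measure_lt_edist_mono hs hst.le

theorem measure_lt_edist_comm (h : μ {ω | t < edist (f ω) (g ω)} ≤ t) :
    μ {ω | t < edist (g ω) (f ω)} ≤ t := by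
  simpa only [edist_comm] using h

theorem measure_lt_edist_add (h₁ : μ {ω | s < edist (f ω) (g ω)} ≤ s)
    (h₂ : μ {ω | t < edist (g ω) (k ω)} ≤ t) :
    μ {ω | s + t < edist (f ω) (k ω)} ≤ s + t := by
  refine (measure_mono (t := {ω | s < edist (f ω) (g ω)} ∪ {ω | t < edist (g ω) (k ω)})
    fun ω hω => ?_).trans ((measure_union_le _ _).trans (add_le_add h₁ h₂))
  by_contra hc
  simp only [mem_union, mem_ofPred_eq, not_or, not_lt] at hc hω
  exact absurd hω (not_lt.2 ((edist_triangle _ _ _).trans (add_le_add hc.1 hc.2)))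

theorem kyFan_le (h : μ {ω | t < edist (f ω) (g ω)} ≤ t) : kyFan μ f g ≤ t := sInf_le h

theorem kyFan_comm : kyFan μ f g = kyFan μ g f := by
  simp only [kyFan, edist_comm]

theorem kyFan_map {Ω' : Type*} [MeasurableSpace Ω'] {q : Ω → Ω'} (hq : Measurable q)
    {f g : Ω' → ℝ} (hf : Measurable f) (hg : Measurable g) :
    kyFan (μ.map q) f g = kyFan μ (fun ω => f (q ω)) (fun ω => g (q ω)) := by
  have h : ∀ ε : ℝ≥0∞, μ.map q {ω | ε < edist (f ω) (g ω)} =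
      μ {ω | ε < edist (f (q ω)) (g (q ω))} := fun ε =>
    Measure.map_apply hq (measurableSet_lt measurable_const (hf.edist hg))
  simp only [kyFan, h]

/-- The integrand is at most `t` off the exceptional set and at most `D` on it, and that set has
mass at most `t`. -/
theorem lintegral_edist_le [IsProbabilityMeasure μ] (hf : Measurable f) (hg : Measurable g)
    {D : ℝ≥0∞} (hD : ∀ ω, edist (f ω) (g ω) ≤ D) (h : μ {ω | t < edist (f ω) (g ω)} ≤ t) :
    ∫⁻ ω, edist (f ω) (g ω) ∂μ ≤ t * (D + 1) := by
  have hB : MeasurableSet {ω | t < edist (f ω) (g ω)} :=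
    measurableSet_lt measurable_const (hf.edist hg)
  calc ∫⁻ ω, edist (f ω) (g ω) ∂μ
      ≤ ∫⁻ ω, (t + {ω | t < edist (f ω) (g ω)}.indicator (fun _ => D) ω) ∂μ := by
        refine lintegral_mono fun ω => ?_
        by_cases hω : t < edist (f ω) (g ω)
        · simp only [indicator, mem_ofPred_eq, hω, if_true]
          exact (hD ω).trans le_add_self
        · exact (not_lt.1 hω).trans le_self_add
    _ = t + D * μ {ω | t < edist (f ω) (g ω)} := by
        rw [lintegral_add_left measurable_const, lintegral_const, measure_univ, mul_one,
          lintegral_indicator_const hB]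
    _ ≤ t + D * t := by gcongr
    _ = t * (D + 1) := by ring

/-- Markov's inequality at the level `r = √c`, where `c / r = r`. Cancelling `r` is what requires `c
≠ 0`. -/
theorem measure_lt_edist_of_lintegral_le (hf : Measurable f) (hg : Measurable g)
    {c : ℝ≥0∞} (hc : c ≠ 0) (h : ∫⁻ ω, edist (f ω) (g ω) ∂μ ≤ c) :
    μ {ω | c ^ (1 / 2 : ℝ) < edist (f ω) (g ω)} ≤ c ^ (1 / 2 : ℝ) := by
  by_cases hc' : c = ⊤
  · simp [hc']
  set r := c ^ (1 / 2 : ℝ)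
  have hr0 : r ≠ 0 := by simp [r, ENNReal.rpow_eq_zero_iff, hc, hc']
  have hr : r ≠ ⊤ := ENNReal.rpow_ne_top_of_nonneg (by norm_num) hc'
  have hrr : r * r = c := by
    rw [← ENNReal.rpow_add _ _ hc hc']; norm_num
  have h1 : r * μ {ω | r ≤ edist (f ω) (g ω)} ≤ r * r :=
    (mul_meas_ge_le_lintegral (hf.edist hg) r).trans (h.trans hrr.ge)
  exact (measure_mono fun ω (hω : r < _) => hω.le).trans
    ((ENNReal.mul_le_mul_iff_right hr0 hr).1 h1)

end KyFan

/-! ### `Aut(X)` as a topological group -/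

namespace MMSpace

variable {X : MMSpace.{u}}

theorem Aut.tendsto_iff {α : Type*} {l : Filter α} {g : α → X.Aut} {g₀ : X.Aut} :
    Tendsto g l (𝓝 g₀) ↔ ∀ x, Tendsto (fun a => g a x) l (𝓝 (g₀ x)) := by
  rw [Aut.isInducing_coe.tendsto_nhds_iff, tendsto_pi_nhds]
  rfl

/-- Pointwise convergence suffices because all the maps are isometries: moving the argument costs
the same under every group element, and inverses reduce to `d(k⁻¹x, g⁻¹x) = d(k(g⁻¹x), x)`. Needed
for Haar measure. -/
instance : IsTopologicalGroup X.Aut where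
  continuous_mul := by
    refine continuous_iff_continuousAt.2 fun p => Aut.tendsto_iff.2 fun x => ?_
    rw [tendsto_iff_dist_tendsto_zero]
    have h1 : Tendsto (fun q : X.Aut × X.Aut => dist (q.2 x) (p.2 x)) (𝓝 p) (𝓝 0) :=
      tendsto_iff_dist_tendsto_zero.1
        (((Aut.continuous_apply x).comp continuous_snd).tendsto p)
    have h2 : Tendsto (fun q : X.Aut × X.Aut => dist (q.1 (p.2 x)) (p.1 (p.2 x))) (𝓝 p) (𝓝 0) :=
      tendsto_iff_dist_tendsto_zero.1
        (((Aut.continuous_apply (p.2 x)).comp continuous_fst).tendsto p)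
    refine squeeze_zero (fun _ => dist_nonneg) (fun q => ?_) (by simpa using h1.add h2)
    calc dist (q.1 (q.2 x)) (p.1 (p.2 x))
        ≤ dist (q.1 (q.2 x)) (q.1 (p.2 x)) + dist (q.1 (p.2 x)) (p.1 (p.2 x)) :=
          dist_triangle _ _ _
      _ = _ := by rw [(Aut.isometry q.1).dist_eq]
  continuous_inv := by
    refine continuous_iff_continuousAt.2 fun g => Aut.tendsto_iff.2 fun x => ?_
    rw [tendsto_iff_dist_tendsto_zero]
    have h : ∀ k : X.Aut, dist (k⁻¹ x) (g⁻¹ x) = dist (k (g⁻¹ x)) x := fun k => by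
      rw [← (Aut.isometry k).dist_eq, Aut.apply_inv_self, dist_comm]
    simp only [h]
    have := ((Aut.continuous_apply (g⁻¹ x)).tendsto g)
    rw [Aut.apply_inv_self] at this
    exact tendsto_iff_dist_tendsto_zero.1 this

end MMSpace

/-! ### Invariant functions and Haar measure -/

namespace EqMMSpace

/-- The quotient map as a map between mm-spaces. -/
def toQuotient (P : EqMMSpace.{u}) : P.space → P.quotient := P.proj

theorem measurable_toQuotient (P : EqMMSpace.{u}) : Measurable P.toQuotient :=
  continuous_proj.measurable

theorem map_toQuotient (P : EqMMSpace.{u}) : P.space.μ.map P.toQuotient = P.quotient.μ := rfl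

theorem toQuotient_apply {P : EqMMSpace.{u}} {g : P.space.Aut} (hg : g ∈ P.group) (x : P.space) :
    P.toQuotient (g x) = P.toQuotient x := proj_apply hg x

theorem lip1_comp_toQuotient {P : EqMMSpace.{u}} {f : P.quotient → ℝ}
    (hf : f ∈ Lip1 P.quotient) : (fun x => f (P.toQuotient x)) ∈ Lip1 P.space := by
  have hf' : LipschitzWith (α := P.Orbits) 1 f := hf
  have := hf'.comp (LipschitzWith.of_dist_le_mul (K := 1) (f := P.proj) fun x y => by
    simpa using dist_proj_le x y)
  rwa [one_mul] at this

/-- A closed subgroup of `Aut(X)` carries a left invariant probability measure. -/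
theorem exists_isMulLeftInvariant (Q : EqMMSpace.{v}) [MeasurableSpace Q.group]
    [BorelSpace Q.group] :
    ∃ ν : Measure Q.group, IsProbabilityMeasure ν ∧ ν.IsMulLeftInvariant := by
  have : CompactSpace Q.group := isCompact_iff_compactSpace.1 Q.isClosed_group.isCompact
  -- By compactness the whole group can serve as the normalizing compact set, so the total mass is
  -- 1.
  exact ⟨Measure.haarMeasure ⊤, ⟨Measure.haarMeasure_self (K₀ := ⊤)⟩, inferInstance⟩

/-- A `G`-invariant `1`-Lipschitz function descends to the quotient. -/
theorem exists_lip1_quotient (Q : EqMMSpace.{v}) {f : Q.space → ℝ} (hf : f ∈ Lip1 Q.space)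
    (hinv : ∀ g ∈ Q.group, ∀ x, f (g x) = f x) :
    ∃ φ ∈ Lip1 Q.quotient, ∀ x, φ (Q.toQuotient x) = f x := by
  have hφ : ∀ x y : Q.space, Q.orbitSetoid x y → f x = f y := by
    rintro x _ ⟨g, hg, rfl⟩
    exact (hinv g hg x).symm
  refine ⟨Quotient.lift f hφ, ?_, fun x => rfl⟩
  change LipschitzWith (α := Q.Orbits) 1 (Quotient.lift f hφ)
  refine LipschitzWith.of_dist_le_mul fun a b => le_of_forall_gt_imp_ge_of_dense fun ε hε => ?_
  obtain ⟨x, rfl⟩ := proj_surjective a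
  rw [NNReal.coe_one, one_mul] at hε
  obtain ⟨y, rfl, hy⟩ := dist_proj_lt_iff.1 hε
  exact (by simpa using LipschitzWith.dist_le_mul hf x y : dist (f x) (f y) ≤ dist x y).trans hy.le

end EqMMSpace

theorem edist_integral_le_lintegral_edist {α : Type*} [MeasurableSpace α] {ν : Measure α}
    [IsProbabilityMeasure ν] {f : α → ℝ} (hf : Integrable f ν) (c : ℝ) :
    edist (∫ a, f a ∂ν) c ≤ ∫⁻ a, edist (f a) c ∂ν := by
  have h : (∫ a, f a ∂ν) - c = ∫ a, (f a - c) ∂ν := by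
    rw [integral_sub hf (integrable_const _)]; simp
  rw [edist_eq_enorm_sub, h]
  simpa only [edist_eq_enorm_sub] using enorm_integral_le_lintegral_enorm (fun a => f a - c)

/-! ### Averaging over the group -/

namespace EqMMSpace

/-- A bounded `1`-Lipschitz function that is close to `u`, along with all its translates, can be
averaged to a function on the quotient that is close to `u`. -/
theorem exists_lip1_quotient_average (Q : EqMMSpace.{v}) {Ω : Type*} [MeasurableSpace Ω]
    {π : Measure Ω} [IsProbabilityMeasure π] {p : Ω → Q.space} (hp : Measurable p)
    {u : Ω → ℝ} (hu : Measurable u) {f : Q.space → ℝ} (hf : f ∈ Lip1 Q.space) {a b : ℝ}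
    (hu' : ∀ ω, u ω ∈ Icc a b) (hf' : ∀ y, f y ∈ Icc a b) {t : ℝ≥0∞} (ht : t ≠ 0)
    (h : ∀ g ∈ Q.group, π {ω | t < edist (u ω) (f (g (p ω)))} ≤ t) :
    ∃ φ ∈ Lip1 Q.quotient,
      π {ω | (t * (ENNReal.ofReal (b - a) + 1)) ^ (1 / 2 : ℝ) < edist (u ω) (φ (Q.toQuotient (p ω)))} ≤
        (t * (ENNReal.ofReal (b - a) + 1)) ^ (1 / 2 : ℝ) := by
  let _ : MeasurableSpace Q.group := borel Q.group
  have : BorelSpace Q.group := ⟨rfl⟩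
  obtain ⟨ν, hν, hν'⟩ := Q.exists_isMulLeftInvariant
  have hfL : LipschitzWith 1 f := hf
  have horb : ∀ y, Continuous fun g : Q.group => (g⁻¹ : Q.group).1 y := fun y =>
    (MMSpace.Aut.continuous_apply y).comp (continuous_subtype_val.comp continuous_inv)
  have hcont : ∀ y, Continuous fun g : Q.group => f ((g⁻¹ : Q.group).1 y) := fun y =>
    hfL.continuous.comp (horb y)
  have hint : ∀ y, Integrable (fun g : Q.group => f ((g⁻¹ : Q.group).1 y)) ν := fun y =>
    Integrable.of_bound (hcont y).measurable.aestronglyMeasurable (max |a| |b|)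
      (ae_of_all _ fun g => abs_le_max_abs_abs (hf' _).1 (hf' _).2)
  -- The inverse matches left invariance: `g⁻¹k = (k⁻¹g)⁻¹`, so replacing `y` by `k y` is a left
  -- translation of the integration variable.
  let F : Q.space → ℝ := fun y => ∫ g : Q.group, f ((g⁻¹ : Q.group).1 y) ∂ν
  have hF : LipschitzWith 1 F := LipschitzWith.of_dist_le_mul fun x y => by
    rw [NNReal.coe_one, one_mul, Real.dist_eq, ← integral_sub (hint x) (hint y)]
    have hb : ∀ g : Q.group, ‖f ((g⁻¹ : Q.group).1 x) - f ((g⁻¹ : Q.group).1 y)‖ ≤ dist x y := by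
      intro g
      have := hfL.dist_le_mul ((g⁻¹ : Q.group).1 x) ((g⁻¹ : Q.group).1 y)
      rwa [NNReal.coe_one, one_mul, (MMSpace.Aut.isometry _).dist_eq] at this
    have := norm_integral_le_of_norm_le_const (μ := ν) (ae_of_all _ hb)
    rwa [probReal_univ, mul_one] at this
  have hinv : ∀ k ∈ Q.group, ∀ y, F (k y) = F y := fun k hk y => by
    have h1 := integral_mul_left_eq_self (μ := ν)
      (fun g : Q.group => f ((g⁻¹ : Q.group).1 y)) (⟨k, hk⟩⁻¹ : Q.group)
    refine Eq.trans ?_ h1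
    refine integral_congr_ae (ae_of_all _ fun g => ?_)
    simp only [mul_inv_rev, inv_inv]
    rfl
  obtain ⟨φ, hφ, hφF⟩ := Q.exists_lip1_quotient hF hinv
  refine ⟨φ, hφ, ?_⟩
  simp only [hφF]
  -- Joint measurability for Tonelli, by the Carathéodory criterion: continuous in the point,
  -- measurable in the group element.
  have hjoint : Measurable (fun q : Q.space × Q.group => f ((q.2⁻¹ : Q.group).1 q.1)) :=
    measurable_uncurry_of_continuous_of_measurable
      (u := fun (y : Q.space) (g : Q.group) => f ((g⁻¹ : Q.group).1 y))
      (fun g => hfL.continuous.comp (MMSpace.Aut.isometry _).continuous)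
      (fun y => (hcont y).measurable)
  refine measure_lt_edist_of_lintegral_le hu (hF.continuous.measurable.comp hp)
    (by simp [ht]) ?_
  calc ∫⁻ ω, edist (u ω) (F (p ω)) ∂π
      ≤ ∫⁻ ω, ∫⁻ g : Q.group, edist (u ω) (f ((g⁻¹ : Q.group).1 (p ω))) ∂ν ∂π := by
        refine lintegral_mono fun ω => ?_
        simp only [edist_comm (u ω)]
        exact edist_integral_le_lintegral_edist (hint (p ω)) (u ω)
    _ = ∫⁻ g : Q.group, ∫⁻ ω, edist (u ω) (f ((g⁻¹ : Q.group).1 (p ω))) ∂π ∂ν := by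
        refine lintegral_lintegral_swap (Measurable.aemeasurable ?_)
        exact (hu.comp measurable_fst).edist
          (hjoint.comp ((hp.comp measurable_fst).prodMk measurable_snd))
    _ ≤ ∫⁻ _ : Q.group, t * (ENNReal.ofReal (b - a) + 1) ∂ν := by
        refine lintegral_mono fun g => lintegral_edist_le hu ?_ (fun ω => ?_)
          (h _ (g⁻¹ : Q.group).2)
        · exact (hfL.continuous.comp (MMSpace.Aut.isometry _).continuous).measurable.comp hp
        · rw [edist_dist]
          exact ENNReal.ofReal_le_ofReal (Real.dist_le_of_mem_Icc (hu' ω) (hf' _))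
    _ = _ := by simp

/-- A function close to a `1`-Lipschitz function and its translates, up to a choice depending on
the translation, is close to a `1`-Lipschitz function on the quotient. -/
theorem exists_lip1_quotient_kyFan_le (Q : EqMMSpace.{v}) {Ω : Type*} [MeasurableSpace Ω]
    {π : Measure Ω} [IsProbabilityMeasure π] {p : Ω → Q.space} (hp : Measurable p)
    (hpπ : π.map p = Q.space.μ) {u : Ω → ℝ} (hu : Measurable u) {a b : ℝ} (hab : a ≤ b)
    {δ κ : ℝ≥0∞} (hδ : δ ≠ 0) (huκ : π {ω | u ω ∉ Icc a b} ≤ κ)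
    (h : ∀ g ∈ Q.group, ∃ f ∈ Lip1 Q.space,
      kyFan π u (fun ω => f (p ω)) < δ ∧ kyFan π u (fun ω => f (g (p ω))) < δ) :
    ∃ φ ∈ Lip1 Q.quotient, kyFan π u (fun ω => φ (Q.toQuotient (p ω))) ≤
      (3 * (ENNReal.ofReal (b - a) + 1) * δ) ^ (1 / 2 : ℝ) + κ := by
  -- The identity is an arbitrary choice; only the closeness of `f` itself to `u` is used.
  obtain ⟨f, hf, hfu, -⟩ := h 1 Q.group.one_mem
  have hfg : ∀ g ∈ Q.group, π {ω | 3 * δ < edist (u ω) (f (g (p ω)))} ≤ 3 * δ := by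
    intro g hg
    obtain ⟨f', hf', h1, h2⟩ := h g hg
    have hfm : Measurable f := (show LipschitzWith 1 f from hf).continuous.measurable
    have hfm' : Measurable f' := (show LipschitzWith 1 f' from hf').continuous.measurable
    have hgm : Measurable g := (MMSpace.Aut.isometry g).continuous.measurable
    have h3 := measure_lt_edist_add
      (measure_lt_edist_comm (measure_lt_edist_of_kyFan_lt h1)) (measure_lt_edist_of_kyFan_lt hfu)
    have hm : MeasurableSet {y | δ + δ < edist (f' y) (f y)} :=
      measurableSet_lt measurable_const (hfm'.edist hfm)
    -- Since `p` has law `Q.space.μ` and `g` preserves it, precomposing both functions with `g`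
    -- leaves the exceptional mass unchanged.
    have h4 : π {ω | δ + δ < edist (f' (g (p ω))) (f (g (p ω)))} ≤ δ + δ := by
      have e1 : π {ω | δ + δ < edist (f' (p ω)) (f (p ω))} =
          Q.space.μ {y | δ + δ < edist (f' y) (f y)} := by
        rw [← hpπ, Measure.map_apply hp hm]; rfl
      have e2 : π {ω | δ + δ < edist (f' (g (p ω))) (f (g (p ω)))} =
          Q.space.μ {y | δ + δ < edist (f' y) (f y)} := by
        rw [← MMSpace.Aut.map_eq g, Measure.map_apply hgm hm, ← hpπ,
          Measure.map_apply hp (hgm hm)]; rfl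
      rwa [e2, ← e1]
    have h5 := measure_lt_edist_add (measure_lt_edist_of_kyFan_lt h2) h4
    rwa [show δ + (δ + δ) = 3 * δ by ring] at h5
  -- Clamping to `[a, b]` is 1-Lipschitz, so it keeps the `3δ` estimates while making both functions
  -- bounded.
  let c : ℝ → ℝ := fun x => projIcc a b hab x
  have hc : LipschitzWith 1 c := by
    have := (LipschitzWith.subtype_val (Icc a b)).comp (LipschitzWith.projIcc hab)
    rwa [one_mul] at this
  have hcm : ∀ x, c x ∈ Icc a b := fun x => (projIcc a b hab x).2
  obtain ⟨φ, hφ, hφc⟩ := Q.exists_lip1_quotient_average (π := π) hp (u := fun ω => c (u ω))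
    (hc.continuous.measurable.comp hu) (f := fun y => c (f y)) (t := 3 * δ)
    (show LipschitzWith 1 (c ∘ f) by simpa using hc.comp (show LipschitzWith 1 f from hf))
    (fun _ => hcm _) (fun _ => hcm _) (by simp [hδ])
    fun g hg => (measure_mono fun ω hω => lt_of_lt_of_le hω
      (by simpa using hc (u ω) (f (g (p ω))))).trans (hfg g hg)
  refine ⟨φ, hφ, kyFan_le ?_⟩
  rw [add_comm, show 3 * (ENNReal.ofReal (b - a) + 1) * δ =
    3 * δ * (ENNReal.ofReal (b - a) + 1) by ring]
  refine measure_lt_edist_add (g := fun ω => c (u ω)) ((measure_mono fun ω hω hω' => ?_).trans huκ) hφc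
  have : c (u ω) = u ω := by simp only [c, projIcc_of_mem hab hω']
  simp [this] at hω

end EqMMSpace

/-! ### Partial diameters through intervals -/

/-- A bounded nonempty real set has the same diameter as the interval from its infimum to its
supremum. The empty set is admissible only when `1 ≤ κ`, and then any interval works. -/
theorem partialDiam_map_lt {Ω : Type*} [MeasurableSpace Ω] {μ : Measure Ω} [IsProbabilityMeasure μ]
    {u : Ω → ℝ} (hu : Measurable u) {κ : ℝ} {D : ℝ≥0∞}
    (h : partialDiam (μ.map u) κ < D) :
    ∃ a b : ℝ, a ≤ b ∧ ENNReal.ofReal (b - a) ≤ D ∧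
      μ {ω | u ω ∉ Icc a b} ≤ ENNReal.ofReal κ := by
  simp only [partialDiam, iInf_lt_iff] at h
  obtain ⟨A, ⟨hA, hAκ⟩, hAD⟩ := h
  rw [Measure.map_apply hu hA] at hAκ
  obtain rfl | hne := A.eq_empty_or_nonempty
  · refine ⟨0, 0, le_rfl, by simp, prob_le_one.trans ?_⟩
    simpa using hAκ
  have hbd : Bornology.IsBounded A := Metric.isBounded_iff_ediam_ne_top.2 (hAD.trans_le le_top).ne
  refine ⟨sInf A, sSup A, csInf_le_csSup hne hbd.bddBelow hbd.bddAbove, ?_, ?_⟩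
  · rw [← Real.ediam_eq hbd]; exact hAD.le
  · have h1 : {ω | u ω ∉ Icc (sInf A) (sSup A)} ⊆ (u ⁻¹' A)ᶜ := fun ω hω hω' =>
      hω (subset_Icc_csInf_csSup hbd.bddBelow hbd.bddAbove hω')
    refine (measure_mono h1).trans ?_
    rw [prob_compl_eq_one_sub (hu hA), tsub_le_iff_right]
    refine le_trans ?_ (add_le_add_right hAκ _)
    rw [← ENNReal.ofReal_one]
    refine le_trans (ENNReal.ofReal_le_ofReal (by linarith : (1 : ℝ) ≤ κ + (1 - κ))) ?_
    exact ENNReal.ofReal_add_le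

theorem partialDiam_map_le {Ω : Type*} [MeasurableSpace Ω] {μ : Measure Ω} [IsProbabilityMeasure μ]
    {u : Ω → ℝ} (hu : Measurable u) {κ a b : ℝ} (hκ : 0 ≤ κ)
    (h : μ {ω | u ω ∉ Icc a b} ≤ ENNReal.ofReal κ) :
    partialDiam (μ.map u) κ ≤ ENNReal.ofReal (b - a) := by
  rw [← Real.ediam_Icc]
  refine iInf₂_le (Icc a b) ⟨measurableSet_Icc, ?_⟩
  rw [Measure.map_apply hu measurableSet_Icc, ENNReal.ofReal_sub _ hκ, ENNReal.ofReal_one,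
    tsub_le_iff_right]
  refine le_trans ?_ (add_le_add_right h _)
  rw [← measure_univ (μ := μ)]
  refine (measure_mono fun ω _ => ?_).trans (measure_union_le (u ⁻¹' Icc a b) _)
  exact em _

/-! ### Couplings and the quotient estimate -/

theorem hausdorffDistOf_le {α β : Type*} {A : Set α} {B : Set β} {ρ : α → β → ℝ≥0∞} {t : ℝ≥0∞}
    (h₁ : ∀ a ∈ A, ∃ b ∈ B, ρ a b ≤ t) (h₂ : ∀ b ∈ B, ∃ a ∈ A, ρ a b ≤ t) :
    hausdorffDistOf A B ρ ≤ t := by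
  refine max_le (iSup₂_le fun a ha => ?_) (iSup₂_le fun b hb => ?_)
  · obtain ⟨b, hb, h⟩ := h₁ a ha
    exact (iInf₂_le b hb).trans h
  · obtain ⟨a, ha, h⟩ := h₂ b hb
    exact (iInf₂_le a ha).trans h

theorem exists_lt_of_hausdorffDistOf_lt {α β : Type*} {A : Set α} {B : Set β}
    {ρ : α → β → ℝ≥0∞} {t : ℝ≥0∞} (h : hausdorffDistOf A B ρ < t) :
    (∀ a ∈ A, ∃ b ∈ B, ρ a b < t) ∧ (∀ b ∈ B, ∃ a ∈ A, ρ a b < t) := by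
  obtain ⟨h₁, h₂⟩ := max_lt_iff.1 h
  refine ⟨fun a ha => ?_, fun b hb => ?_⟩
  · simpa only [iInf_lt_iff, exists_prop] using
      (le_iSup₂ (f := fun a (_ : a ∈ A) => ⨅ b ∈ B, ρ a b) a ha).trans_lt h₁
  · simpa only [iInf_lt_iff, exists_prop] using
      (le_iSup₂ (f := fun b (_ : b ∈ B) => ⨅ a ∈ A, ρ a b) b hb).trans_lt h₂

theorem Couplings.isProbabilityMeasure {X : MMSpace.{u}} {Y : MMSpace.{v}} {π : Measure (X × Y)}
    (hπ : π ∈ Couplings X Y) : IsProbabilityMeasure π := by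
  refine ⟨?_⟩
  rw [← measure_univ (μ := X.μ), ← hπ.1, Measure.map_apply measurable_fst MeasurableSet.univ,
    preimage_univ]

theorem measurable_of_mem_lip1 {X : MMSpace.{u}} {f : X → ℝ} (hf : f ∈ Lip1 X) : Measurable f :=
  (show LipschitzWith 1 f from hf).continuous.measurable

theorem exists_coupling_of_eqObsDist_lt {P : EqMMSpace.{u}} {Q : EqMMSpace.{v}} {δ : ℝ≥0∞}
    (h : eqObsDist P Q < δ) :
    ∃ π ∈ Couplings P.space Q.space,
      (∀ g ∈ P.group, ∃ k ∈ Q.group, rhoDist π g k < δ) ∧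
        ∀ k ∈ Q.group, ∃ g ∈ P.group, rhoDist π g k < δ := by
  simp only [eqObsDist, iInf_lt_iff] at h
  obtain ⟨π, hπ, h⟩ := h
  exact ⟨π, hπ, exists_lt_of_hausdorffDistOf_lt h⟩

theorem Couplings.map_toQuotient {P : EqMMSpace.{u}} {Q : EqMMSpace.{v}}
    {π : Measure (P.space × Q.space)} (hπ : π ∈ Couplings P.space Q.space) :
    π.map (Prod.map P.toQuotient Q.toQuotient) ∈ Couplings P.quotient Q.quotient := by
  have hP : Measurable P.toQuotient := P.measurable_toQuotient
  have hQ : Measurable Q.toQuotient := Q.measurable_toQuotient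
  constructor
  · rw [Measure.map_map measurable_fst (hP.prodMap hQ), Prod.map_fst', ← P.map_toQuotient, ← hπ.1,
      Measure.map_map hP measurable_fst]
  · rw [Measure.map_map measurable_snd (hP.prodMap hQ), Prod.map_snd', ← Q.map_toQuotient, ← hπ.2,
      Measure.map_map hQ measurable_snd]

theorem obsDist_le_of_coupling {X : MMSpace.{u}} {Y : MMSpace.{v}} {π : Measure (X × Y)}
    (hπ : π ∈ Couplings X Y) {t : ℝ≥0∞}
    (h₁ : ∀ f ∈ Lip1 X, ∃ f' ∈ Lip1 Y, kyFan π (fun p => f p.1) (fun p => f' p.2) ≤ t)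
    (h₂ : ∀ f' ∈ Lip1 Y, ∃ f ∈ Lip1 X, kyFan π (fun p => f p.1) (fun p => f' p.2) ≤ t) :
    obsDist X Y ≤ t := by
  have h : rhoDist π (1 : X.Aut) (1 : Y.Aut) ≤ t := by
    refine hausdorffDistOf_le (fun f hf => ?_) (fun f' hf' => ?_)
    · obtain ⟨f', hf', h⟩ := h₁ f hf
      exact ⟨f', hf', max_le h h⟩
    · obtain ⟨f, hf, h⟩ := h₂ f' hf'
      exact ⟨f, hf, max_le h h⟩
  refine (iInf₂_le (α := ℝ≥0∞) π hπ).trans (hausdorffDistOf_le ?_ ?_)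
  · exact fun g hg => ⟨1, rfl, by rwa [show g = 1 from hg]⟩
  · exact fun g hg => ⟨1, rfl, by rwa [show g = 1 from hg]⟩

theorem exists_Icc_of_obsDiam_lt {X : MMSpace.{u}} {κ : ℝ} {D : ℝ≥0∞} (h : obsDiam X κ < D)
    {Ω : Type*} [MeasurableSpace Ω] {π : Measure Ω} [IsProbabilityMeasure π] {p : Ω → X}
    (hp : Measurable p) (hpπ : π.map p = X.μ) {f : X → ℝ} (hf : f ∈ Lip1 X) :
    ∃ a b : ℝ, a ≤ b ∧ ENNReal.ofReal (b - a) ≤ D ∧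
      π {ω | f (p ω) ∉ Icc a b} ≤ ENNReal.ofReal κ := by
  have hfm := measurable_of_mem_lip1 hf
  refine partialDiam_map_lt (hfm.comp hp) ?_
  rw [← Measure.map_map hfm hp, hpπ]
  exact (le_iSup₂ (f := fun f (_ : f ∈ Lip1 X) => partialDiam (X.μ.map f) κ) f hf).trans_lt h

/-- The quantitative bound with strict upper bounds `D` and `δ`, which leave room to pick a
coupling, group partners and intervals without attaining any infimum. -/
theorem obsDist_quotient_le {P : EqMMSpace.{u}} {Q : EqMMSpace.{v}} {κ : ℝ}
    {D δ : ℝ≥0∞} (hPD : obsDiam P.space κ < D) (hQD : obsDiam Q.space κ < D)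
    (hδ : eqObsDist P Q < δ) :
    obsDist P.quotient Q.quotient ≤
      (3 * (D + 1) * δ) ^ (1 / 2 : ℝ) + ENNReal.ofReal κ := by
  obtain ⟨π, hπ, h₁, h₂⟩ := exists_coupling_of_eqObsDist_lt hδ
  have := Couplings.isProbabilityMeasure hπ
  have hP : Measurable P.toQuotient := P.measurable_toQuotient
  have hQ : Measurable Q.toQuotient := Q.measurable_toQuotient
  have hPQ := hP.prodMap hQ
  have hδ0 : δ ≠ 0 := (bot_le.trans_lt hδ).ne'
  have hky : ∀ f ∈ Lip1 P.quotient, ∀ f' ∈ Lip1 Q.quotient,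
      kyFan (π.map (Prod.map P.toQuotient Q.toQuotient))
        (fun p : P.quotient × Q.quotient => f p.1) (fun p => f' p.2) =
      kyFan π (fun p => f (P.toQuotient p.1)) (fun p => f' (Q.toQuotient p.2)) := fun f hf f' hf' =>
    kyFan_map hPQ ((measurable_of_mem_lip1 hf).comp (measurable_fst))
      ((measurable_of_mem_lip1 hf').comp (measurable_snd))
  refine obsDist_le_of_coupling (Couplings.map_toQuotient hπ) (fun f hf => ?_) (fun f' hf' => ?_)
  · have hF := EqMMSpace.lip1_comp_toQuotient hf
    obtain ⟨a, b, hab, habD, hu⟩ :=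
      exists_Icc_of_obsDiam_lt hPD (π := π) measurable_fst hπ.1 hF
    obtain ⟨φ, hφ, hle⟩ := Q.exists_lip1_quotient_kyFan_le (π := π) measurable_snd hπ.2
      ((measurable_of_mem_lip1 hF).comp measurable_fst) hab hδ0 hu
      (fun k hk => by
        obtain ⟨g, hg, hlt⟩ := h₂ k hk
        obtain ⟨f', hf', hm⟩ := (exists_lt_of_hausdorffDistOf_lt hlt).1 _ hF
        -- The lifted function is `G`-invariant, so the partner `g` disappears and both Ky Fan terms
        -- compare with the same function.
        simp only [EqMMSpace.toQuotient_apply hg] at hm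
        exact ⟨f', hf', (max_lt_iff.1 hm).1, (max_lt_iff.1 hm).2⟩)
    refine ⟨φ, hφ, ?_⟩
    rw [hky f hf φ hφ]
    exact hle.trans (by gcongr)
  · have hF := EqMMSpace.lip1_comp_toQuotient hf'
    obtain ⟨a, b, hab, habD, hu⟩ :=
      exists_Icc_of_obsDiam_lt hQD (π := π) measurable_snd hπ.2 hF
    obtain ⟨φ, hφ, hle⟩ := P.exists_lip1_quotient_kyFan_le (π := π) measurable_fst hπ.1
      ((measurable_of_mem_lip1 hF).comp measurable_snd) hab hδ0 hu
      (fun g hg => by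
        obtain ⟨k, hk, hlt⟩ := h₁ g hg
        obtain ⟨f, hf, hm⟩ := (exists_lt_of_hausdorffDistOf_lt hlt).2 _ hF
        simp only [EqMMSpace.toQuotient_apply hk] at hm
        rw [kyFan_comm, kyFan_comm (f := fun p : P.space × Q.space => f (g p.1))] at hm
        exact ⟨f, hf, (max_lt_iff.1 hm).1, (max_lt_iff.1 hm).2⟩)
    refine ⟨φ, hφ, ?_⟩
    rw [hky φ hφ f' hf', kyFan_comm]
    exact hle.trans (by gcongr)

/-! ### Bounds on observable diameters -/

/-- Some ball of radius `n` misses mass at most `κ`, and every 1-Lipschitz function maps it into an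
interval of length `2n`. -/
theorem obsDiam_ne_top (X : MMSpace.{u}) {κ : ℝ} (hκ : 0 < κ) : obsDiam X κ ≠ ⊤ := by
  obtain ⟨x₀⟩ : Nonempty X := inferInstance
  have hlim := tendsto_measure_iUnion_atTop (μ := X.μ)
    (s := fun n : ℕ => Metric.closedBall x₀ n)
    fun m n hmn => Metric.closedBall_subset_closedBall (by exact_mod_cast hmn)
  rw [Metric.iUnion_closedBall_nat, measure_univ] at hlim
  have hlt : 1 - ENNReal.ofReal κ < 1 :=
    ENNReal.sub_lt_self ENNReal.one_ne_top one_ne_zero (by simpa using hκ)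
  obtain ⟨n, hn⟩ := (hlim.eventually (lt_mem_nhds hlt)).exists
  have hn' : X.μ (Metric.closedBall x₀ n)ᶜ ≤ ENNReal.ofReal κ := by
    rw [prob_compl_eq_one_sub Metric.isClosed_closedBall.measurableSet]
    exact tsub_le_iff_tsub_le.1 hn.le
  suffices h : obsDiam X κ ≤ ENNReal.ofReal (n + n) from (h.trans_lt ENNReal.ofReal_lt_top).ne
  refine iSup₂_le fun f hf => ?_
  rw [show (n : ℝ) + n = (f x₀ + n) - (f x₀ - n) by ring]
  refine partialDiam_map_le (measurable_of_mem_lip1 hf) hκ.le ((measure_mono (compl_subset_compl.2 fun x hx' => ?_)).trans hn')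
  have h1 := (show LipschitzWith 1 f from hf).dist_le_mul x x₀
  rw [NNReal.coe_one, one_mul, Real.dist_eq] at h1
  have h2 := abs_le.1 (h1.trans (Metric.mem_closedBall.1 hx'))
  exact ⟨by linarith, by linarith⟩

theorem obsDiam_anti (X : MMSpace.{u}) {κ κ' : ℝ} (h : κ ≤ κ') : obsDiam X κ' ≤ obsDiam X κ :=
  iSup₂_mono fun _ _ => biInf_mono fun _ hA =>
    ⟨hA.1, (ENNReal.ofReal_le_ofReal (by linarith)).trans hA.2⟩

/-- An interval for a nearby function on `Q.space`, widened by 1 on each side, serves for `f`. One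
`κ` pays for that interval, the other for the Ky Fan exceptional set; the 3 is this widening by 2
plus a slack of 1 for choosing the interval. -/
theorem obsDiam_le_of_eqObsDist_lt {P : EqMMSpace.{u}} {Q : EqMMSpace.{v}} {κ : ℝ} (hκ : 0 < κ)
    (h₁ : eqObsDist P Q < 1) (h : eqObsDist P Q < ENNReal.ofReal κ) :
    obsDiam P.space (κ + κ) ≤ obsDiam Q.space κ + 3 := by
  obtain ⟨π, hπ, h₁, -⟩ := exists_coupling_of_eqObsDist_lt (lt_min h₁ h)
  have := Couplings.isProbabilityMeasure hπ
  obtain ⟨k, hk, hlt⟩ := h₁ 1 P.group.one_mem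
  refine iSup₂_le fun f hf => ?_
  obtain ⟨f', hf', hm⟩ := (exists_lt_of_hausdorffDistOf_lt hlt).1 f hf
  have hff' := measure_lt_edist_of_kyFan_lt (max_lt_iff.1 hm).1
  obtain ⟨a, b, hab, habD, hu⟩ := exists_Icc_of_obsDiam_lt
    (ENNReal.lt_add_right (obsDiam_ne_top Q.space hκ) one_ne_zero) (π := π) measurable_snd hπ.2 hf'
  have hfm := measurable_of_mem_lip1 hf
  rw [← hπ.1, Measure.map_map hfm measurable_fst]
  refine (partialDiam_map_le (hfm.comp measurable_fst) (a := a - 1) (b := b + 1) (by positivity)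
    ?_).trans ?_
  · rw [ENNReal.ofReal_add hκ.le hκ.le]
    refine (measure_mono fun p hp => ?_).trans ((measure_union_le _ _).trans
      (add_le_add hu (hff'.trans (min_le_right _ _))))
    by_contra hc
    simp only [mem_union, mem_ofPred_eq, not_or, not_lt, not_not] at hc
    refine hp ?_
    have h3 := hc.2.trans (min_le_left _ _)
    rw [edist_dist, ENNReal.ofReal_le_one, Real.dist_eq, abs_le] at h3
    have h4 := hc.1
    refine ⟨?_, ?_⟩ <;> simp only [Function.comp_apply] <;> linarith [h4.1, h4.2]
  · rw [show b + 1 - (a - 1) = (b - a) + 2 by ring,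
      ENNReal.ofReal_add (by linarith) (by norm_num)]
    refine (add_le_add_left habD _).trans ?_
    rw [add_assoc]
    norm_num

/-! ### The theorem -/

theorem mainTheorem4 :
    (∀ (P : EqMMSpace.{u}) (Q : EqMMSpace.{v}) (κ : ℝ), 0 < κ →
      obsDist P.quotient Q.quotient ≤
        (3 * (max (obsDiam P.space κ) (obsDiam Q.space κ) + 1) * eqObsDist P Q) ^ (1 / 2 : ℝ)
          + ENNReal.ofReal κ) ∧
    (∀ (P : ℕ → EqMMSpace.{u}) (Q : EqMMSpace.{v}),
      Tendsto (fun n => eqObsDist (P n) Q) atTop (𝓝 0) →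
        Tendsto (fun n => obsDist (P n).quotient Q.quotient) atTop (𝓝 0)) := by
  have main : ∀ (P : EqMMSpace.{u}) (Q : EqMMSpace.{v}) (κ : ℝ), 0 < κ →
      obsDist P.quotient Q.quotient ≤
        (3 * (max (obsDiam P.space κ) (obsDiam Q.space κ) + 1) * eqObsDist P Q) ^ (1 / 2 : ℝ)
          + ENNReal.ofReal κ := by
    intro P Q κ hκ
    have hP := obsDiam_ne_top P.space hκ
    have hQ := obsDiam_ne_top Q.space hκ
    by_cases hd : eqObsDist P Q = ⊤
    · have h3 : 3 * (max (obsDiam P.space κ) (obsDiam Q.space κ) + 1) ≠ 0 := by simp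
      rw [hd, ENNReal.mul_top h3, ENNReal.top_rpow_of_pos (by norm_num), top_add]
      exact le_top
    have hM : max (obsDiam P.space κ) (obsDiam Q.space κ) ≠ ⊤ :=
      (max_lt hP.lt_top hQ.lt_top).ne
    set M := max (obsDiam P.space κ) (obsDiam Q.space κ)
    have hid : Tendsto (fun ε : ℝ≥0∞ => ε) (𝓝[>] 0) (𝓝 0) := nhdsWithin_le_nhds
    -- The strict bounds `M + ε` and `eqObsDist P Q + ε` are relaxed by letting `ε` decrease to 0;
    -- finiteness of both quantities gives continuity of the product.
    have hlim : Tendsto (fun ε : ℝ≥0∞ => (3 * (M + ε + 1) * (eqObsDist P Q + ε)) ^ (1 / 2 : ℝ)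
        + ENNReal.ofReal κ) (𝓝[>] 0)
        (𝓝 ((3 * (M + 0 + 1) * (eqObsDist P Q + 0)) ^ (1 / 2 : ℝ) + ENNReal.ofReal κ)) := by
      refine Tendsto.add (Tendsto.ennrpow_const _ ?_) tendsto_const_nhds
      refine ENNReal.Tendsto.mul (ENNReal.Tendsto.const_mul
        ((tendsto_const_nhds.add hid).add tendsto_const_nhds) (Or.inr (by simp))) (Or.inr ?_)
        (tendsto_const_nhds.add hid) (Or.inr ?_)
      · simpa using hd
      · exact ENNReal.mul_ne_top (by simp) (by simp [hM])
    rw [add_zero, add_zero] at hlim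
    refine ge_of_tendsto hlim ?_
    filter_upwards [self_mem_nhdsWithin] with ε hε
    have hε0 : ε ≠ 0 := (show (0 : ℝ≥0∞) < ε from hε).ne'
    have hMlt : M < M + ε := ENNReal.lt_add_right hM hε0
    exact obsDist_quotient_le ((le_max_left _ _).trans_lt hMlt)
      ((le_max_right _ _).trans_lt hMlt) (ENNReal.lt_add_right hd hε0)
  refine ⟨main, fun P Q h => ?_⟩
  refine ENNReal.tendsto_nhds_zero.2 fun ε hε => ?_
  obtain ⟨κ, hκ, hκε⟩ : ∃ κ : ℝ, 0 < κ ∧ ENNReal.ofReal (κ + κ) < ε := by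
    obtain ⟨r, hr, hrε⟩ := ENNReal.lt_iff_exists_nnreal_btwn.1 hε
    refine ⟨r / 2, by simpa using hr, ?_⟩
    rwa [add_halves, ENNReal.ofReal_coe_nnreal]
  -- This constant eventually dominates the factor for `(P n, Q)` at level `2κ`, and it does not
  -- depend on `n`.
  have hC : 3 * (obsDiam Q.space κ + 3 + 1) ≠ ⊤ :=
    ENNReal.mul_ne_top (by simp) (by simp [obsDiam_ne_top Q.space hκ])
  have hlim : Tendsto (fun n => (3 * (obsDiam Q.space κ + 3 + 1) * eqObsDist (P n) Q) ^ (1 / 2 : ℝ)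
      + ENNReal.ofReal (κ + κ)) atTop (𝓝 (ENNReal.ofReal (κ + κ))) := by
    have := ((ENNReal.Tendsto.const_mul h (Or.inr hC)).ennrpow_const (1 / 2 : ℝ)).add_const
      (ENNReal.ofReal (κ + κ))
    rwa [mul_zero, ENNReal.zero_rpow_of_pos (by norm_num), zero_add] at this
  filter_upwards [hlim.eventually (gt_mem_nhds hκε),
    h.eventually (gt_mem_nhds zero_lt_one),
    h.eventually (gt_mem_nhds (show 0 < ENNReal.ofReal κ by simpa using hκ))] with n h1 h2 h3
  refine (main (P n) Q (κ + κ) (by positivity)).trans (le_trans ?_ h1.le)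
  gcongr
  exact max_le (obsDiam_le_of_eqObsDist_lt hκ h2 h3)
    ((obsDiam_anti Q.space (by linarith)).trans le_self_add)
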